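/- A twofold triple system $\mathrm{TTS}(v)$ consists of a set $V$ of $v$ points and a finite collection $\mathcal{B}$ of $3$-element subsets of $V$ (blocks, repetitions allowed) such that every $2$-element subset of $V$ is contained in exactly two blocks of $\mathcal{B}$. Its $2$-block-intersection graph ($2$-BIG) has the blocks in $\mathcal{B}$ as vertices, two blocks $B_1, B_2$ being adjacent if and only if $|B_1 \cap B_2| = 2$. Theorem. Let $v$ be a positive integer with $v \ge 7$ if $v$ is odd and $v \ge 4$ if $v$ is even. If there exists a $\mathrm{TTS}(v)$ whose $2$-BIG has a Hamilton cycle, then there exists a $\mathrm{TTS}(2v+1)$ whose $2$-BIG has a Hamilton cycle. -/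

import Mathlib

/-- A balanced incomplete block design `BIBD(v, k, lam)` on the finite point set `V`: there are `v`
points, every block has `k` points, and any two distinct points lie together in exactly `lam`
blocks. Blocks are given as a family `B` indexed by a finite type, so that repeated blocks are
allowed and are counted with multiplicity. -/
structure IsBIBD {V ι : Type} [Fintype V] [DecidableEq V] [Fintype ι]
    (v k lam : ℕ) (B : ι → Finset V) : Prop where
  card_points : Fintype.card V = v
  card_block : ∀ i, (B i).card = k
  card_pair : ∀ x y : V, x ≠ y →
    (Finset.univ.filter fun i => x ∈ B i ∧ y ∈ B i).card = lam

/-- A twofold triple system `TTS(v)`. -/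
abbrev IsTTS {V ι : Type} [Fintype V] [DecidableEq V] [Fintype ι]
    (v : ℕ) (B : ι → Finset V) : Prop :=
  IsBIBD v 3 2 B

/-- The `n`-block-intersection graph: its vertices are the blocks (the indices of the family), two
different ones being adjacent when the blocks have exactly `n` points in common. -/
def blockIntersectionGraph {V ι : Type} [DecidableEq V]
    (n : ℕ) (B : ι → Finset V) : SimpleGraph ι where
  Adj i j := i ≠ j ∧ (B i ∩ B j).card = n
  symm := ⟨fun i j h => ⟨h.1.symm, by rw [Finset.inter_comm]; exact h.2⟩⟩
  loopless := ⟨fun _ h => h.1 rfl⟩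

/-- There is a `TTS(v)` whose 2-block-intersection graph is Hamiltonian. -/
def ExistsTTSWithHamiltonianTwoBIG (v : ℕ) : Prop :=
  ∃ (V ι : Type) (_ : Fintype V) (_ : DecidableEq V) (_ : Fintype ι) (_ : DecidableEq ι)
    (B : ι → Finset V), IsTTS v B ∧ (blockIntersectionGraph 2 B).IsHamiltonian

/-! Keep the `v` old points and add `v + 1` new ones, namely `Z` with `v` elements and a point ∞
(`none`). Take Hamilton paths `r j` on `Z`, one per old point `y j`, running from `f j` to `f (j +
1)` with indices cyclic, that together join each pair twice. Closing each path through ∞ and coning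
it from `y j` covers every mixed pair and every pair of new points twice (`sum_pairCount_fullCone`),
so the cones and the old blocks form a `TTS(2v + 1)`.

A cone is a linked list of triples. It ends in `{y j, f (j + 1), ∞}` and the next begins with `{y (j
+ 1), ∞, f (j + 1)}`, so the cones close up into one cycle, disjoint from the old Hamilton cycle. A
Pasch trade merges the two. The blocks `{y 0, y 1, y (n + 3)}`, `{y 1, f 2, ∞}`, `{y 0, f 0, f 2}`,
`{y (n + 3), f 0, ∞}` cover the same twelve pairs as `{y 1, y (n + 3), ∞}`, `{y 0, y 1, f 2}`, `{y
0, y (n + 3), f 0}`, `{∞, f 0, f 2}` (`pairCount_newBlocks`). With the old points labelled to suit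
the neighbours of the removed old block, the inserted blocks reconnect the pieces into a single
cycle (`isSegment_newBlocks`, `IsCyclicTTS.double`).

The paths are zigzags on `ZMod v`: all translates when `v` is odd; when `v` is even, half of them,
interleaved with a permuted copy of the other half. -/

/-! ### Hamilton cycles of blocks as cyclic lists -/

/-- Two blocks are linked when they have exactly two points in common. -/
def Linked {V : Type} [DecidableEq V] (s t : Finset V) : Prop := (s ∩ t).card = 2

/-- The number of blocks in a list that contain both `x` and `y`. -/
def pairCount {V : Type} [DecidableEq V] (x y : V) (L : List (Finset V)) : ℕ :=
  L.countP fun s => x ∈ s ∧ y ∈ s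

theorem pairCount_map_of_nodup {V ι : Type} [DecidableEq V] [Fintype ι] (B : ι → Finset V)
    {l : List ι} (hl : l.Nodup) (hmem : ∀ i, i ∈ l) (x y : V) :
    pairCount x y (l.map B) = (Finset.univ.filter fun i => x ∈ B i ∧ y ∈ B i).card := by
  classical
  have h : (Finset.univ.filter fun i => x ∈ B i ∧ y ∈ B i) =
      (l.filter fun i => x ∈ B i ∧ y ∈ B i).toFinset := by
    ext i; simp [hmem]
  rw [h, List.toFinset_card_of_nodup (hl.filter _), pairCount, List.countP_map,
    List.countP_eq_length_filter]
  rfl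

theorem Linked.symm {V : Type} [DecidableEq V] {s t : Finset V} (h : Linked s t) : Linked t s := by
  unfold Linked at *; rwa [Finset.inter_comm]

/-- The blocks of a `TTS(v)`, listed along a Hamilton cycle of its 2-block-intersection graph. -/
structure IsCyclicTTS {V : Type} [Fintype V] [DecidableEq V] (v : ℕ) (T : Finset V)
    (L : List (Finset V)) : Prop where
  card_points : Fintype.card V = v
  card_block : ∀ s ∈ T :: L, s.card = 3
  two_le : 2 ≤ L.length
  chain : (T :: L).IsChain Linked
  closed : ∀ s ∈ L.getLast?, Linked s T
  pairCount_eq : ∀ x y, x ≠ y → pairCount x y (T :: L) = 2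

theorem exists_isCyclicTTS {v : ℕ} (hv : 2 ≤ v) (h : ExistsTTSWithHamiltonianTwoBIG v) :
    ∃ (V : Type) (_ : Fintype V) (_ : DecidableEq V) (T : Finset V) (L : List (Finset V)),
      IsCyclicTTS v T L := by
  obtain ⟨V, ι, _, _, _, _, B, hB, hH⟩ := h
  -- `IsHamiltonian` holds by convention on a one-vertex graph. That case is excluded because some
  -- pair of points lies in two blocks.
  have hcard : Fintype.card ι ≠ 1 := by
    intro h1
    obtain ⟨x, y, hxy⟩ := Fintype.one_lt_card_iff.1
      (show 1 < Fintype.card V by rw [hB.card_points]; omega)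
    have h2 := hB.card_pair x y hxy
    have h3 := Finset.card_le_univ (Finset.univ.filter fun i => x ∈ B i ∧ y ∈ B i)
    omega
  obtain ⟨a, p, hp⟩ := hH hcard
  have hlen := hp.isCycle.three_le_length
  cases p with
  | nil => simp at hlen
  | @cons _ b _ hab q =>
    have hq : q.IsHamiltonian := by
      have := hp.isHamiltonian_tail
      simpa [SimpleGraph.Walk.IsHamiltonian] using this
    obtain ⟨l, hl⟩ : ∃ l, q.support = b :: l := ⟨_, q.cons_tail_support.symm⟩
    have hll : 2 ≤ l.length := by
      have := q.length_support
      simp [hl] at this hlen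
      omega
    have hlast : l.getLast? = some a := by
      have h1 : q.support.getLast? = some a := by
        rw [List.getLast?_eq_getLast_of_ne_nil q.support_ne_nil, q.getLast_support]
      have hne : l ≠ [] := by rintro rfl; simp at hll
      rw [hl, List.getLast?_cons_of_ne_nil hne] at h1
      exact h1
    refine ⟨V, inferInstance, inferInstance, B b, l.map B, hB.card_points, ?_, by simpa, ?_, ?_, ?_⟩
    · intro s hs
      rw [← List.map_cons, List.mem_map] at hs
      obtain ⟨i, -, rfl⟩ := hs
      exact hB.card_block i
    · rw [← List.map_cons, ← hl]
      exact List.isChain_map_of_isChain B (fun i j hij => hij.2) q.isChain_adj_support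
    · intro s hs
      rw [List.getLast?_map, hlast] at hs
      simp at hs
      subst hs
      exact hab.2
    · intro x y hxy
      rw [← hB.card_pair x y hxy, ← List.map_cons, ← hl]
      exact pairCount_map_of_nodup B hq.isPath.support_nodup hq.mem_support x y

/-- The identity on indices is a homomorphism from the standard cycle graph, whose Hamilton cycle is
pushed forward along it. -/
theorem exists_hamiltonian_of_fin {V : Type} [Fintype V] [DecidableEq V] {v n : ℕ}
    (B : Fin (n + 3) → Finset V) (hB : IsTTS v B) (hlink : ∀ i, Linked (B i) (B (i + 1))) :
    ExistsTTSWithHamiltonianTwoBIG v := by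
  refine ⟨V, Fin (n + 3), inferInstance, inferInstance, inferInstance, inferInstance, B, hB,
    fun _ => ?_⟩
  have hne : ∀ i : Fin (n + 3), i ≠ i + 1 := fun i => by simp
  let f : SimpleGraph.cycleGraph (n + 3) →g blockIntersectionGraph 2 B :=
    { toFun := id
      map_rel' := by
        intro i j hij
        rcases SimpleGraph.cycleGraph_adj.1 hij with h | h
        · obtain rfl : i = j + 1 := by rw [← h]; abel
          exact ⟨(hne j).symm, (hlink j).symm⟩
        · obtain rfl : j = i + 1 := by rw [← h]; abel
          exact ⟨hne i, hlink i⟩ }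
  refine ⟨_, (SimpleGraph.cycleGraph.cycle n).map f,
    SimpleGraph.Walk.IsHamiltonianCycle.map Function.bijective_id
      ⟨SimpleGraph.cycleGraph.isCycle_cycle, ?_⟩⟩
  rw [SimpleGraph.Walk.isHamiltonian_iff_isPath_and_length_eq]
  refine ⟨SimpleGraph.cycleGraph.isPath_tail_cycle, ?_⟩
  have h1 := SimpleGraph.Walk.length_tail_add_one
    (SimpleGraph.cycleGraph.isCycle_cycle (n := n)).not_nil
  rw [SimpleGraph.cycleGraph.length_cycle] at h1
  simp only [Fintype.card_fin]
  omega

theorem IsCyclicTTS.existsTTS {V : Type} [Fintype V] [DecidableEq V] {v : ℕ} {T : Finset V}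
    {L : List (Finset V)} (h : IsCyclicTTS v T L) : ExistsTTSWithHamiltonianTwoBIG v := by
  obtain ⟨n, hn⟩ : ∃ n, (T :: L).length = n + 3 :=
    ⟨L.length - 2, by have := h.two_le; simp; omega⟩
  have hB : ∀ i : Fin (n + 3), (i : ℕ) < (T :: L).length := fun i => by rw [hn]; exact i.2
  refine exists_hamiltonian_of_fin (n := n) (fun i => (T :: L)[(i : ℕ)]'(hB i))
    ⟨h.card_points, fun i => h.card_block _ (List.getElem_mem _), fun x y hxy => ?_⟩ fun i => ?_
  · rw [← h.pairCount_eq x y hxy]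
    have : T :: L = List.ofFn fun i : Fin (n + 3) => (T :: L)[(i : ℕ)]'(hB i) := by
      apply List.ext_getElem
      · simp only [List.length_ofFn, hn]
      · intro i h1 h2
        rw [List.getElem_ofFn]
    conv_rhs => rw [this]
    rw [List.ofFn_eq_map]
    exact (pairCount_map_of_nodup _ (List.nodup_finRange _) List.mem_finRange x y).symm
  · by_cases hi : (i : ℕ) + 1 < n + 3
    · have h1 : ((i + 1 : Fin (n + 3)) : ℕ) = i + 1 := Fin.val_add_one_of_lt' hi
      simp only [h1]
      exact h.chain.getElem _ (by rw [hn]; exact hi)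
    · have h2 : (i : ℕ) = n + 2 := by have := i.2; omega
      have h1 : i + 1 = 0 := by
        have : i = Fin.last (n + 2) := Fin.ext h2
        rw [this]; simp
      simp only [h1, h2]
      have h3 : L.length = n + 2 := by simpa using hn
      refine h.closed _ ?_
      simp [List.getLast?_eq_getElem?, h3]

/-! ### Pairs covered by the cone over a path -/

section PairCount

variable {α : Type} [DecidableEq α]

/-- The indicator of `e = s(a, b)`, as a natural number. -/
def edgeInd (e : Sym2 α) (a b : α) : ℕ := if e = s(a, b) then 1 else 0

/-- The number of consecutive pairs of a list that are equal to `e`. -/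
def edgeCount (e : Sym2 α) : List α → ℕ
  | a :: b :: l => edgeInd e a b + edgeCount e (b :: l)
  | _ => 0

/-- The triples formed by an apex `u` and two consecutive entries of a list. -/
def cone (u : α) : List α → List (Finset α)
  | a :: b :: l => {u, a, b} :: cone u (b :: l)
  | _ => []

theorem edgeInd_comm (e : Sym2 α) (a b : α) : edgeInd e a b = edgeInd e b a := by
  unfold edgeInd; rw [Sym2.eq_swap]

theorem edgeInd_eq_zero {e : Sym2 α} {a b : α} (h : e ≠ s(a, b)) : edgeInd e a b = 0 := if_neg h

theorem pairCount_append (x y : α) (L M : List (Finset α)) :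
    pairCount x y (L ++ M) = pairCount x y L + pairCount x y M := List.countP_append

theorem pairCount_cons (x y : α) (s : Finset α) (L : List (Finset α)) :
    pairCount x y (s :: L) = pairCount x y [s] + pairCount x y L :=
  pairCount_append x y [s] L

@[simp] theorem pairCount_nil (x y : α) : pairCount x y [] = 0 := rfl

theorem pairCount_swap (x y : α) (L : List (Finset α)) : pairCount x y L = pairCount y x L := by
  unfold pairCount; congr 1; ext s; simp [and_comm]

theorem pairCount_triple {a b c x y : α} (hab : a ≠ b) (hac : a ≠ c) (hbc : b ≠ c) (hxy : x ≠ y) :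
    pairCount x y [{a, b, c}] =
      edgeInd s(x, y) a b + edgeInd s(x, y) a c + edgeInd s(x, y) b c := by
  simp only [pairCount, List.countP_singleton, edgeInd, Sym2.eq_iff, decide_eq_true_eq,
    Finset.mem_insert, Finset.mem_singleton]
  grind

@[simp] theorem cone_cons_cons (u a b : α) (l : List α) :
    cone u (a :: b :: l) = {u, a, b} :: cone u (b :: l) := rfl

@[simp] theorem edgeCount_cons_cons (e : Sym2 α) (a b : α) (l : List α) :
    edgeCount e (a :: b :: l) = edgeInd e a b + edgeCount e (b :: l) := rfl

theorem cone_cons {u a b : α} : ∀ {l : List α}, l.head? = some b →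
    cone u (a :: l) = {u, a, b} :: cone u l
  | b' :: l, h => by simp at h; subst h; rfl

theorem cone_concat {u a b : α} : ∀ {l : List α}, l.getLast? = some a →
    cone u (l ++ [b]) = cone u l ++ [{u, a, b}]
  | [c], h => by simp at h; subst h; rfl
  | c :: d :: l, h => by
    have h' : (d :: l).getLast? = some a := by simpa using h
    have := cone_concat (u := u) (b := b) h'
    simpa using this

theorem card_of_mem_cone {u : α} {t : Finset α} : ∀ {l : List α}, u ∉ l → l.IsChain (· ≠ ·) →
    t ∈ cone u l → t.card = 3
  | [], _, _, h => by simp [cone] at h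
  | [a], _, _, h => by simp [cone] at h
  | a :: b :: l, hu, hc, h => by
    simp only [List.isChain_cons_cons] at hc
    simp only [cone_cons_cons, List.mem_cons] at h hu
    rcases h with rfl | h
    · push Not at hu
      exact Finset.card_eq_three.2 ⟨u, a, b, hu.1, hu.2.1, hc.1, rfl⟩
    · exact card_of_mem_cone (by simp; tauto) hc.2 h

/-- Each interior entry of the list lies in two triples of the cone, each end in one. -/
theorem pairCount_cone {u x y : α} (hxy : x ≠ y) {b : α} : ∀ {l : List α} {a : α}, u ∉ l →
    l.IsChain (· ≠ ·) → l.head? = some a → l.getLast? = some b →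
    pairCount x y (cone u l) + edgeInd s(x, y) u a + edgeInd s(x, y) u b =
      edgeCount s(x, y) l + 2 * (l.map (edgeInd s(x, y) u)).sum
  | [c], a, hu, hc, ha, hb => by
    simp at ha hb; subst ha hb
    simp [cone, edgeCount]; ring
  | c :: d :: l, a, hu, hc, ha, hb => by
    simp only [List.isChain_cons_cons] at hc
    simp only [List.head?_cons, Option.some.injEq] at ha
    subst ha
    have hu' : u ∉ d :: l := by simp at hu ⊢; tauto
    have ih := pairCount_cone hxy hu' hc.2 rfl (by simpa using hb)
    have huc : u ≠ c := by simp at hu; tauto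
    have hud : u ≠ d := by simp at hu; tauto
    rw [cone_cons_cons, pairCount_cons, pairCount_triple huc hud hc.1 hxy, edgeCount_cons_cons]
    rw [List.map_cons, List.sum_cons]
    omega

theorem edgeCount_map {β : Type} [DecidableEq β] {φ : α → β} (hφ : φ.Injective) (e : Sym2 α) :
    ∀ l : List α, edgeCount (e.map φ) (l.map φ) = edgeCount e l
  | [] => rfl
  | [_] => rfl
  | a :: b :: l => by
    have ih := edgeCount_map hφ e (b :: l)
    have h : edgeInd (e.map φ) (φ a) (φ b) = edgeInd e a b := by
      simp only [edgeInd, ← Sym2.map_mk, (Sym2.map.injective hφ).eq_iff]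
    simp only [List.map_cons, edgeCount_cons_cons] at ih ⊢
    rw [ih, h]

theorem edgeCount_eq_zero {e : Sym2 α} : ∀ {l : List α}, (∀ a ∈ l, ∀ b ∈ l, e ≠ s(a, b)) →
    edgeCount e l = 0
  | [], _ => rfl
  | [_], _ => rfl
  | a :: b :: l, h => by
    rw [edgeCount_cons_cons, edgeInd_eq_zero (h a (by simp) b (by simp)), zero_add]
    exact edgeCount_eq_zero fun c hc d hd => h c (by simp_all) d (by simp_all)

end PairCount

/-! ### Linked lists of blocks -/

section Segments

variable {α : Type} [DecidableEq α]

/-- A list of blocks from `a` to `b` in which consecutive blocks are linked. -/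
structure IsSegment (L : List (Finset α)) (a b : Finset α) : Prop where
  chain : L.IsChain Linked
  head : L.head? = some a
  last : L.getLast? = some b

theorem IsSegment.singleton (a : Finset α) : IsSegment [a] a a :=
  ⟨List.isChain_singleton a, rfl, rfl⟩

theorem IsSegment.append {L M : List (Finset α)} {a b c d : Finset α} (hL : IsSegment L a b)
    (hM : IsSegment M c d) (h : Linked b c) : IsSegment (L ++ M) a d := by
  refine ⟨hL.chain.append hM.chain ?_, ?_, ?_⟩
  · intro x hx y hy
    rw [hL.last] at hx
    rw [hM.head] at hy
    simp at hx hy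
    subst hx hy
    exact h
  · rw [List.head?_append, hL.head]; rfl
  · rw [List.getLast?_append, hM.last]; rfl

theorem IsSegment.cons {M : List (Finset α)} {a c d : Finset α}
    (hM : IsSegment M c d) (h : Linked a c) : IsSegment (a :: M) a d :=
  (IsSegment.singleton a).append hM h

theorem IsSegment.concat {L : List (Finset α)} {a b c : Finset α} (hL : IsSegment L a b)
    (h : Linked b c) : IsSegment (L ++ [c]) a c :=
  hL.append (IsSegment.singleton c) h

/-- Two triples that share the pair `{p, q}` and differ in their third points are linked. -/
theorem linked_of_eq {s t : Finset α} {p q x y : α} (hs : s = {p, q, x}) (ht : t = {p, q, y})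
    (hpq : p ≠ q) (hxy : x ≠ y) : Linked s t := by
  have : s ∩ t = {p, q} := by
    subst hs ht; ext z; simp; grind
  rw [Linked, this, Finset.card_pair hpq]

/-- Consecutive triples share the apex and the common vertex of two successive edges. The third
points `c` and `d` of the end triples are exposed so that the cone can be joined to other blocks. -/
theorem isSegment_cone {u b : α} : ∀ {l : List α} {a : α}, u ∉ l → l.Nodup → 2 ≤ l.length →
    l.head? = some a → l.getLast? = some b →
    ∃ c ∈ l, ∃ d ∈ l, c ≠ a ∧ d ≠ b ∧ IsSegment (cone u l) {u, a, c} {u, d, b}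
  | [], a, _, _, h, _, _ => by simp at h
  | [c], a, _, _, h, _, _ => by simp at h
  | [c, d], a, hu, hl, _, ha, hb => by
    simp at ha hb hl; subst ha hb
    exact ⟨d, by simp, c, by simp, Ne.symm hl, hl, IsSegment.singleton _⟩
  | c :: d :: e :: l, a, hu, hl, _, ha, hb => by
    simp only [List.head?_cons, Option.some.injEq] at ha
    subst ha
    have hu' : u ∉ d :: e :: l := by simp at hu ⊢; tauto
    obtain ⟨c', hc', d', hd', hca, hdb, ih⟩ := isSegment_cone (a := d) hu' (List.nodup_cons.1 hl).2
      (by simp) rfl (by simpa using hb)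
    have hcd : c ≠ d := by rintro rfl; simp at hl
    have hcc : c' ≠ c := by rintro rfl; exact (List.nodup_cons.1 hl).1 hc'
    refine ⟨d, by simp, d', List.mem_cons_of_mem _ hd', hcd.symm, hdb, ?_⟩
    rw [cone_cons_cons]
    have hud : u ≠ d := by rintro rfl; simp at hu
    exact ih.cons (linked_of_eq (p := u) (q := d) (x := c) (y := c') (by grind) rfl hud hcc.symm)

end Segments

/-! ### Cyclic families of Hamilton paths -/

/-- A cyclic family of Hamilton paths `r j` from `f j` to `f (j + 1)` on `Z` in which each pair of
points is joined exactly twice. -/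
structure IsPathFamily {Z : Type} [DecidableEq Z] (v : ℕ) (r : ℕ → List Z) (f : ℕ → Z) : Prop where
  nodup : ∀ j < v, (r j).Nodup
  mem : ∀ j < v, ∀ w, w ∈ r j
  head : ∀ j < v, (r j).head? = some (f j)
  last : ∀ j < v, (r j).getLast? = some (f (j + 1))
  closed : f v = f 0
  start : ∃ t, r 0 = f 0 :: f 2 :: t
  bijOn : Set.BijOn f (Set.Iio v) Set.univ
  twice : ∀ a b, a ≠ b → ∑ j ∈ Finset.range v, edgeCount s(a, b) (r j) = 2

theorem sum_indicator_of_bijOn {Z : Type} [DecidableEq Z] {v : ℕ} {f : ℕ → Z}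
    (h : Set.BijOn f (Set.Iio v) Set.univ) (w : Z) :
    ∑ j ∈ Finset.range v, (if f j = w then 1 else 0) = 1 := by
  obtain ⟨i, hi, rfl⟩ := h.surjOn (Set.mem_univ w)
  rw [Finset.sum_eq_single_of_mem i (by simpa using hi)]
  · simp
  · intro j hj hji
    rw [if_neg]
    exact fun he => hji (h.injOn (by simpa using hj) hi he)

/-! ### The old block to be removed, and labels for the old points -/

section Old

variable {V : Type} [DecidableEq V]

/-- Each neighbour omits exactly one point of `T`: `N` omits `b` and `P` omits `a`. These differ
because the intersections do, and the remaining point `c` lies in both. -/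
theorem exists_eq_triple {T N P : Finset V} (hT : T.card = 3) (hN : Linked T N) (hP : Linked P T)
    (hne : T ∩ N ≠ T ∩ P) : ∃ a b c, a ≠ b ∧ a ≠ c ∧ b ≠ c ∧ T = {a, b, c} ∧
      a ∈ N ∧ c ∈ N ∧ b ∈ P ∧ c ∈ P := by
  have h1 : (T \ N).card = 1 := by
    have := Finset.card_sdiff_add_card_inter T N
    unfold Linked at hN; omega
  have h2 : (T \ P).card = 1 := by
    have := Finset.card_sdiff_add_card_inter T P
    have hP' := hP.symm
    unfold Linked at hP'; omega
  obtain ⟨b, hb⟩ := Finset.card_eq_one.1 h1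
  obtain ⟨a, ha⟩ := Finset.card_eq_one.1 h2
  have hab : a ≠ b := by
    rintro rfl
    apply hne
    have e1 : T ∩ N = T \ {a} := by rw [← hb]; ext; simp
    have e2 : T ∩ P = T \ {a} := by rw [← ha]; ext; simp
    rw [e1, e2]
  have hb' : b ∈ T \ N := by simp [hb]
  have ha' : a ∈ T \ P := by simp [ha]
  rw [Finset.mem_sdiff] at ha' hb'
  have h3 : ((T.erase a).erase b).card = 1 := by
    rw [Finset.card_erase_of_mem (by simp [hab.symm, hb'.1]), Finset.card_erase_of_mem ha'.1, hT]
  obtain ⟨c, hc⟩ := Finset.card_eq_one.1 h3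
  have hc' : c ∈ (T.erase a).erase b := by simp [hc]
  simp only [Finset.mem_erase] at hc'
  have memN : ∀ x ∈ T, x ≠ b → x ∈ N := fun x hx hxb => by
    by_contra h
    exact hxb (by simpa [hb] using Finset.mem_sdiff.2 ⟨hx, h⟩)
  have memP : ∀ x ∈ T, x ≠ a → x ∈ P := fun x hx hxb => by
    by_contra h
    exact hxb (by simpa [ha] using Finset.mem_sdiff.2 ⟨hx, h⟩)
  refine ⟨a, b, c, hab, Ne.symm hc'.2.1, Ne.symm hc'.1, ?_, memN a ha'.1 hab,
    memN c hc'.2.2 hc'.1, memP b hb'.1 hab.symm, memP c hc'.2.2 hc'.2.1⟩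
  rw [← hc, Finset.insert_erase, Finset.insert_erase ha'.1]
  simp [hab.symm, hb'.1]

theorem IsCyclicTTS.exists_triple [Fintype V] {v : ℕ} {T : Finset V} {L : List (Finset V)}
    (h : IsCyclicTTS v T L) : ∃ N P, IsSegment L N P ∧ ∃ a b c, a ≠ b ∧ a ≠ c ∧ b ≠ c ∧
      T = {a, b, c} ∧ a ∈ N ∧ c ∈ N ∧ b ∈ P ∧ c ∈ P := by
  have hlen := h.two_le
  obtain ⟨N, M, rfl⟩ : ∃ N M, L = N :: M := List.exists_cons_of_ne_nil (by rintro rfl; simp at hlen)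
  have hM : M ≠ [] := by rintro rfl; simp at hlen
  obtain ⟨M, P, rfl⟩ : ∃ M' P, M = M' ++ [P] := ⟨_, _, (List.dropLast_append_getLast hM).symm⟩
  have hlast : (N :: (M ++ [P])).getLast? = some P := by
    rw [List.getLast?_cons]; simp
  have hTN : Linked T N := by
    have := h.chain; rw [List.isChain_cons_cons] at this; exact this.1
  have hPT : Linked P T := h.closed P (by rw [hlast]; rfl)
  refine ⟨N, P, ⟨h.chain.tail, rfl, hlast⟩,
    exists_eq_triple (h.card_block T (by simp)) hTN hPT fun he => ?_⟩
  -- If the two intersections agreed, this pair would lie in the three blocks `T`, `N` and `P`.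
  obtain ⟨p, q, hpq, hE⟩ := Finset.card_eq_two.1 hTN
  have hp : p ∈ T ∩ N := by simp [hE]
  have hq : q ∈ T ∩ N := by simp [hE]
  have hp' := hp; have hq' := hq
  rw [he] at hp' hq'
  simp only [Finset.mem_inter] at hp hq hp' hq'
  have h2 := h.pairCount_eq p q hpq
  rw [pairCount_cons, pairCount_cons p q N, pairCount_append] at h2
  simp [pairCount, hp, hq, hp', hq'] at h2
  omega

theorem exists_enumeration [Fintype V] {n : ℕ} (hV : Fintype.card V = n + 4) {a b c : V} (hab : a ≠ b)
    (hac : a ≠ c) (hbc : b ≠ c) : ∃ y : ℕ → V, y 0 = a ∧ y 1 = b ∧ y (n + 3) = c ∧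
      Set.BijOn y (Set.Iio (n + 4)) Set.univ := by
  obtain ⟨e, h0, h1, h2⟩ : ∃ e : Fin (n + 4) ≃ V, e 0 = a ∧ e 1 = b ∧ e (Fin.last _) = c := by
    -- Three transpositions set the three values in turn; distinctness keeps each from disturbing
    -- the earlier ones.
    let e₀ := (Fintype.equivFinOfCardEq hV).symm
    let e₁ := e₀.trans (Equiv.swap (e₀ 0) a)
    let e₂ := e₁.trans (Equiv.swap (e₁ 1) b)
    let e₃ := e₂.trans (Equiv.swap (e₂ (Fin.last _)) c)
    have h01 : (0 : Fin (n + 4)) ≠ 1 := by simp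
    have h02 : (0 : Fin (n + 4)) ≠ Fin.last _ := by simp [Fin.ext_iff]
    have h12 : (1 : Fin (n + 4)) ≠ Fin.last _ := by simp [Fin.ext_iff]
    have a1 : e₁ 0 = a := by simp [e₁]
    have a2 : e₂ 0 = a := by
      simp only [e₂, Equiv.trans_apply, a1]
      exact Equiv.swap_apply_of_ne_of_ne (fun h => h01 (e₁.injective (a1.trans h))) hab
    have b2 : e₂ 1 = b := by simp [e₂]
    refine ⟨e₃, ?_, ?_, by simp [e₃]⟩
    · simp only [e₃, Equiv.trans_apply, a2]
      exact Equiv.swap_apply_of_ne_of_ne (fun h => h02 (e₂.injective (a2.trans h))) hac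
    · simp only [e₃, Equiv.trans_apply, b2]
      exact Equiv.swap_apply_of_ne_of_ne (fun h => h12 (e₂.injective (b2.trans h))) hbc
  refine ⟨fun j => if hj : j < n + 4 then e ⟨j, hj⟩ else a, ?_, ?_, ?_, fun _ _ => Set.mem_univ _,
    ?_, ?_⟩
  · simpa using h0
  · simpa using h1
  · simpa [Fin.last] using h2
  · intro i hi j hj hij
    simp only [Set.mem_Iio] at hi hj
    simp only [hi, hj, dif_pos] at hij
    simpa using e.injective hij
  · intro w _
    refine ⟨e.symm w, (e.symm w).2, by simp⟩

end Old

/-! ### Cones with an old apex over new points -/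

section Doubling

variable {V Z : Type} [DecidableEq V] [DecidableEq Z]

/-- The triple formed by an old point and two new points. -/
def newTriple (u : V) (a b : Option Z) : Finset (V ⊕ Option Z) := {.inl u, .inr a, .inr b}

/-- The cone with an old apex over a path of finite new points. -/
def innerCone (u : V) (l : List Z) : List (Finset (V ⊕ Option Z)) :=
  cone (.inl u) (l.map fun w => .inr (some w))

/-- The cone with an old apex over the cycle obtained by joining both ends `a` and `b` of a path to
the point at infinity. -/
def fullCone (u : V) (l : List Z) (a b : Z) : List (Finset (V ⊕ Option Z)) :=
  newTriple u none (some a) :: (innerCone u l ++ [newTriple u (some b) none])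

theorem isSegment_innerCone (u : V) {l : List Z} {a b : Z} (hl : l.Nodup) (hlen : 2 ≤ l.length)
    (ha : l.head? = some a) (hb : l.getLast? = some b) :
    ∃ c d, c ≠ a ∧ d ≠ b ∧
      IsSegment (innerCone u l) (newTriple u (some a) (some c)) (newTriple u (some d) (some b)) := by
  have hinj : Function.Injective fun w : Z => (Sum.inr (some w) : V ⊕ Option Z) := by
    intro x y h; simpa using h
  obtain ⟨c, hc, d, hd, hca, hdb, h⟩ := isSegment_cone (u := (Sum.inl u : V ⊕ Option Z))
    (l := l.map fun w => .inr (some w)) (a := .inr (some a)) (b := .inr (some b)) (by simp)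
    (hl.map hinj) (by simpa) (by simp [ha]) (by simp [hb])
  simp only [List.mem_map] at hc hd
  obtain ⟨c, -, rfl⟩ := hc
  obtain ⟨d, -, rfl⟩ := hd
  exact ⟨c, d, by simpa using hca, by simpa using hdb, h⟩

theorem isSegment_fullCone (u : V) {l : List Z} {a b : Z} (hl : l.Nodup) (hlen : 2 ≤ l.length)
    (ha : l.head? = some a) (hb : l.getLast? = some b) :
    IsSegment (fullCone u l a b) (newTriple u none (some a)) (newTriple u (some b) none) := by
  obtain ⟨c, d, -, -, h⟩ := isSegment_innerCone u hl hlen ha hb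
  refine (h.concat ?_).cons ?_
  · exact linked_of_eq (p := .inl u) (q := .inr (some b)) (x := .inr (some d)) (y := .inr none)
      (by unfold newTriple; grind) rfl (by simp) (by simp)
  · exact linked_of_eq (p := .inl u) (q := .inr (some a)) (x := .inr none) (y := .inr (some c))
      (by unfold newTriple; grind) rfl (by simp) (by simp)

end Doubling

section Doubling

variable {V Z : Type} [DecidableEq V] [DecidableEq Z]

theorem sum_map_ite_eq_count (w : Z) (l : List Z) :
    (l.map fun x => if w = x then 1 else 0).sum = l.count w := by
  induction l with
  | nil => rfl
  | cons a l ih =>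
    rw [List.map_cons, List.sum_cons, ih, List.count_cons, add_comm]
    by_cases h : w = a
    · simp [h]
    · simp [h, Ne.symm h]

theorem pairCount_newTriple {u : V} {a b : Option Z} (hab : a ≠ b) {x y : V ⊕ Option Z}
    (hxy : x ≠ y) : pairCount x y [newTriple u a b] =
      edgeInd s(x, y) (.inl u) (.inr a) + edgeInd s(x, y) (.inl u) (.inr b) +
        edgeInd s(x, y) (.inr a) (.inr b) :=
  pairCount_triple (by simp) (by simp) (by simpa using hab) hxy

/-- The two triples through ∞ supply exactly the end terms missing in `pairCount_cone`: in the
closed cycle every vertex has degree two. -/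
theorem pairCount_fullCone {x y : V ⊕ Option Z} (hxy : x ≠ y) (u : V) {l : List Z} {a b : Z}
    (hl : l.Nodup) (ha : l.head? = some a) (hb : l.getLast? = some b) :
    pairCount x y (fullCone u l a b) =
      edgeCount s(x, y) (l.map fun w => .inr (some w)) +
      2 * (l.map fun w => edgeInd s(x, y) (.inl u) (.inr (some w))).sum +
      2 * edgeInd s(x, y) (.inl u) (.inr none) +
      edgeInd s(x, y) (.inr (some a)) (.inr none) + edgeInd s(x, y) (.inr (some b)) (.inr none) := by
  have hinj : Function.Injective fun w : Z => (Sum.inr (some w) : V ⊕ Option Z) := by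
    intro x y h; simpa using h
  have h := pairCount_cone hxy (u := (Sum.inl u : V ⊕ Option Z))
    (l := l.map fun w => .inr (some w)) (a := .inr (some a)) (b := .inr (some b)) (by simp)
    (hl.map hinj).isChain (by simp [ha]) (by simp [hb])
  rw [fullCone, pairCount_cons, pairCount_append, pairCount_newTriple (by simp) hxy,
    pairCount_newTriple (by simp) hxy, innerCone]
  rw [List.map_map] at h
  have hc := edgeInd_comm s(x, y) (Sum.inr none) (Sum.inr (some a))
  simp only [Function.comp_def] at h
  omega

/-- The pairs covered by the full cones over a path family. -/
theorem sum_pairCount_fullCone {v : ℕ} {r : ℕ → List Z} {f : ℕ → Z} (hr : IsPathFamily v r f)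
    {y : ℕ → V} (hy : Set.BijOn y (Set.Iio v) Set.univ) :
    (∀ p q : V, p ≠ q → ∑ j ∈ Finset.range v,
      pairCount (Sum.inl p) (Sum.inl q) (fullCone (y j) (r j) (f j) (f (j + 1))) = 0) ∧
    (∀ (p : V) (w : Option Z), ∑ j ∈ Finset.range v,
      pairCount (Sum.inl p) (Sum.inr w) (fullCone (y j) (r j) (f j) (f (j + 1))) = 2) ∧
    (∀ w z : Option Z, w ≠ z → ∑ j ∈ Finset.range v,
      pairCount (Sum.inr w) (Sum.inr z) (fullCone (y j) (r j) (f j) (f (j + 1))) = 2) := by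
  have hinj : Function.Injective fun w : Z => (Sum.inr (some w) : V ⊕ Option Z) := by
    intro x y h; simpa using h
  have key : ∀ x y' : V ⊕ Option Z, x ≠ y' → ∑ j ∈ Finset.range v,
      pairCount x y' (fullCone (y j) (r j) (f j) (f (j + 1))) = ∑ j ∈ Finset.range v,
      (edgeCount s(x, y') ((r j).map fun w => .inr (some w)) +
      2 * ((r j).map fun w => edgeInd s(x, y') (.inl (y j)) (.inr (some w))).sum +
      2 * edgeInd s(x, y') (.inl (y j)) (.inr none) +
      edgeInd s(x, y') (.inr (some (f j))) (.inr none) +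
      edgeInd s(x, y') (.inr (some (f (j + 1)))) (.inr none)) := fun x y' hxy =>
    Finset.sum_congr rfl fun j hj => by
      rw [Finset.mem_range] at hj
      exact pairCount_fullCone hxy _ (hr.nodup j hj) (hr.head j hj) (hr.last j hj)
  refine ⟨fun p q hpq => ?_, fun p w => ?_, fun w z hwz => ?_⟩
  · rw [key _ _ (by simpa using hpq)]
    refine Finset.sum_eq_zero fun j _ => ?_
    rw [edgeCount_eq_zero (by simp)]
    simp [edgeInd]
  -- Only the cone with apex `p` contributes, and its cycle passes once through each new point,
  -- giving two triples there.
  · have hone : ∑ j ∈ Finset.range v, 2 * (if y j = p then 1 else 0) = 2 := by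
      rw [← Finset.mul_sum, sum_indicator_of_bijOn hy p, mul_one]
    rw [key _ _ (by simp)]
    refine Eq.trans ?_ hone
    refine Finset.sum_congr rfl fun j hj => ?_
    rw [Finset.mem_range] at hj
    rw [edgeCount_eq_zero (by simp)]
    by_cases hp : y j = p
    · cases w with
      | none => simp [edgeInd, hp]
      | some w =>
        have h2 : ((r j).map fun x => if w = x then 1 else 0).sum = 1 := by
          rw [sum_map_ite_eq_count, List.count_eq_one_of_mem (hr.nodup j hj) (hr.mem j hj w)]
        simp [edgeInd, hp, h2]
    · have hp' : p ≠ y j := Ne.symm hp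
      simp [edgeInd, hp, hp']
  · rw [key _ _ (by simpa using hwz)]
    -- Since `f v = f 0`, the final vertices of the paths also run once through `Z`; so ∞ is joined
    -- to each point once from a start and once from an end.
    have hshift : ∀ w, ∑ j ∈ Finset.range v, (if f (j + 1) = w then 1 else 0) = 1 := fun w => by
      have h1 := Finset.sum_range_succ (fun j => if f j = w then 1 else 0) v
      rw [Finset.sum_range_succ', sum_indicator_of_bijOn hr.bijOn, hr.closed] at h1
      omega
    have hnone : ∀ w : Z, ∑ j ∈ Finset.range v,
        ((if f j = w then 1 else 0) + (if f (j + 1) = w then 1 else 0)) = 2 := fun w => by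
      rw [Finset.sum_add_distrib, hshift, sum_indicator_of_bijOn hr.bijOn]
    cases w with
    | none =>
      cases z with
      | none => exact absurd rfl hwz
      | some z =>
        rw [← hnone z]
        refine Finset.sum_congr rfl fun j _ => ?_
        rw [edgeCount_eq_zero (by simp)]
        simp [edgeInd, eq_comm]
    | some w =>
      cases z with
      | none =>
        rw [← hnone w]
        refine Finset.sum_congr rfl fun j _ => ?_
        rw [edgeCount_eq_zero (by simp)]
        simp [edgeInd, eq_comm]
      | some z =>
        rw [← hr.twice w z (by simpa using hwz)]
        refine Finset.sum_congr rfl fun j _ => ?_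
        have := edgeCount_map hinj s(w, z) (r j)
        simp only [Sym2.map_mk] at this
        rw [this]
        simp [edgeInd]

end Doubling

/-! ### The new blocks in cyclic order -/

section Assembly

variable {V Z : Type}

/-- A block of the old system, seen as a block of the new one. -/
def oldBlock (Z : Type) (s : Finset V) : Finset (V ⊕ Option Z) := s.map ⟨Sum.inl, Sum.inl_injective⟩

@[simp] theorem inl_mem_oldBlock {s : Finset V} {x : V} : Sum.inl x ∈ oldBlock Z s ↔ x ∈ s := by
  simp [oldBlock]

@[simp] theorem inr_notMem_oldBlock {s : Finset V} {w : Option Z} : Sum.inr w ∉ oldBlock Z s := by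
  simp [oldBlock]

variable [DecidableEq V] [DecidableEq Z]

theorem Linked.oldBlock {s t : Finset V} (h : Linked s t) :
    Linked (oldBlock Z s) (oldBlock Z t) := by
  unfold Linked at *
  rw [_root_.oldBlock, _root_.oldBlock, ← Finset.map_inter, Finset.card_map, h]

theorem pairCount_inl_inl_old (p q : V) (L : List (Finset V)) :
    pairCount (Sum.inl p) (Sum.inl q) (L.map (oldBlock Z)) = pairCount p q L := by
  unfold pairCount
  rw [List.countP_map]
  congr 1
  ext s
  simp

theorem pairCount_inr_old (x : V ⊕ Option Z) (w : Option Z) (L : List (Finset V)) :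
    pairCount x (Sum.inr w) (L.map (oldBlock Z)) = 0 := by
  unfold pairCount
  rw [List.countP_map, List.countP_eq_zero]
  intro s _
  simp

theorem linked_oldBlock_of_mem {s : Finset V} {t : Finset (V ⊕ Option Z)} {p q : V}
    {w : Option Z} (hpq : p ≠ q) (hp : p ∈ s) (hq : q ∈ s)
    (ht : t = {.inl p, .inl q, .inr w}) : Linked t (oldBlock Z s) := by
  have : t ∩ oldBlock Z s = {.inl p, .inl q} := by
    subst ht
    ext x
    rcases x with x | x
    · simp; grind
    · simp
  rw [Linked, this, Finset.card_pair (by simpa using hpq)]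

/-- The concatenation of the full cones over the paths `2, …, m + 1`. -/
def middleCones (y : ℕ → V) (r : ℕ → List Z) (f : ℕ → Z) (m : ℕ) : List (Finset (V ⊕ Option Z)) :=
  (List.range m).flatMap fun i => fullCone (y (i + 2)) (r (i + 2)) (f (i + 2)) (f (i + 3))

theorem middleCones_succ (y : ℕ → V) (r : ℕ → List Z) (f : ℕ → Z) (m : ℕ) :
    middleCones y r f (m + 1) =
      middleCones y r f m ++ fullCone (y (m + 2)) (r (m + 2)) (f (m + 2)) (f (m + 3)) := by
  simp [middleCones, List.range_succ]

theorem pairCount_middleCones (p q : V ⊕ Option Z) (y : ℕ → V) (r : ℕ → List Z) (f : ℕ → Z)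
    (m : ℕ) : pairCount p q (middleCones y r f m) = ∑ i ∈ Finset.range m,
      pairCount p q (fullCone (y (i + 2)) (r (i + 2)) (f (i + 2)) (f (i + 3))) := by
  induction m with
  | zero => rfl
  | succ m ih => rw [middleCones_succ, pairCount_append, ih, Finset.sum_range_succ]

/-- Successive cones are linked through the pair formed by ∞ and the common end of their paths,
their apices being different. -/
theorem isSegment_middleCones {v : ℕ} {r : ℕ → List Z} {f : ℕ → Z} (hr : IsPathFamily v r f)
    (hlen : ∀ j < v, 2 ≤ (r j).length) {y : ℕ → V} (hy : Set.InjOn y (Set.Iio v)) {m : ℕ}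
    (hm : m + 2 < v) : IsSegment (middleCones y r f (m + 1)) (newTriple (y 2) none (some (f 2)))
      (newTriple (y (m + 2)) (some (f (m + 3))) none) := by
  induction m with
  | zero => simpa [middleCones] using
      isSegment_fullCone (y 2) (hr.nodup 2 hm) (hlen 2 hm) (hr.head 2 hm) (hr.last 2 hm)
  | succ m ih =>
    rw [middleCones_succ]
    refine (ih (by omega)).append (isSegment_fullCone _ (hr.nodup _ hm) (hlen _ hm) (hr.head _ hm)
      (hr.last _ hm)) ?_
    have hne : y (m + 2) ≠ y (m + 3) := fun h => by
      have := hy (by simp; omega) (by simp; omega) h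
      omega
    refine linked_of_eq (p := .inr none) (q := .inr (some (f (m + 3)))) (x := .inl (y (m + 2)))
      (y := .inl (y (m + 3))) ?_ ?_ (by simp) (by simpa using hne)
    · unfold newTriple; grind
    · unfold newTriple; grind

theorem card_newTriple {u : V} {a b : Option Z} (hab : a ≠ b) : (newTriple u a b).card = 3 :=
  Finset.card_eq_three.2 ⟨_, _, _, by simp, by simp, by simpa using hab, rfl⟩

theorem card_of_mem_innerCone {u : V} {l : List Z} (hl : l.Nodup) {s : Finset (V ⊕ Option Z)}
    (hs : s ∈ innerCone u l) : s.card = 3 := by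
  have hinj : Function.Injective fun w : Z => (Sum.inr (some w) : V ⊕ Option Z) := by
    intro x y h; simpa using h
  exact card_of_mem_cone (by simp) (hl.map hinj).isChain hs

theorem card_of_mem_middleCones {v : ℕ} {r : ℕ → List Z} {f : ℕ → Z} (hr : IsPathFamily v r f)
    {y : ℕ → V} {m : ℕ} (hm : m + 2 ≤ v) {s : Finset (V ⊕ Option Z)}
    (hs : s ∈ middleCones y r f m) : s.card = 3 := by
  simp only [middleCones, List.mem_flatMap, List.mem_range, fullCone, List.mem_cons,
    List.mem_append, List.not_mem_nil, or_false] at hs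
  obtain ⟨i, hi, rfl | hs | rfl⟩ := hs
  · exact card_newTriple (by simp)
  · exact card_of_mem_innerCone (hr.nodup _ (by omega)) hs
  · exact card_newTriple (by simp)

/-- Two old points and a new one. -/
def mixedTriple (u u' : V) (w : Option Z) : Finset (V ⊕ Option Z) := {.inl u, .inl u', .inr w}

/-- The blocks that follow `mixedTriple (y 1) (y (n + 3)) none` and precede the old blocks. -/
def newBlocks (y : ℕ → V) (r : ℕ → List Z) (f : ℕ → Z) (n : ℕ) : List (Finset (V ⊕ Option Z)) :=
  newTriple (y 1) none (some (f 1)) :: (innerCone (y 1) (r 1) ++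
    mixedTriple (y 0) (y 1) (some (f 2)) :: (innerCone (y 0) (r 0).tail ++
    newTriple (y 0) (some (f 1)) none :: newTriple (y 0) none (some (f 0)) ::
    {.inr none, .inr (some (f 0)), .inr (some (f 2))} :: (middleCones y r f (n + 1) ++
    newTriple (y (n + 3)) none (some (f (n + 3))) :: (innerCone (y (n + 3)) (r (n + 3)) ++
    [mixedTriple (y 0) (y (n + 3)) (some (f 0))]))))

variable {n : ℕ} {r : ℕ → List Z} {f : ℕ → Z} {y : ℕ → V}

theorem IsPathFamily.f_ne (hr : IsPathFamily (n + 4) r f) {i j : ℕ} (hi : i < n + 4)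
    (hj : j < n + 4) (hij : i ≠ j) : f i ≠ f j := fun h => hij (hr.bijOn.injOn hi hj h)

/-- Three, not two, because the path `r 0` loses its first edge in the trade and its tail must still
have an edge. -/
theorem IsPathFamily.three_le_length (hr : IsPathFamily (n + 4) r f) {j : ℕ} (hj : j < n + 4) :
    3 ≤ (r j).length := by
  have h : ({f 0, f 1, f 2} : Finset Z) ⊆ (r j).toFinset := fun w _ => by simpa using hr.mem j hj w
  have h1 := Finset.card_le_card h
  rw [Finset.card_eq_three.2 ⟨f 0, f 1, f 2, hr.f_ne (by omega) (by omega) (by omega),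
    hr.f_ne (by omega) (by omega) (by omega), hr.f_ne (by omega) (by omega) (by omega), rfl⟩] at h1
  exact h1.trans (List.toFinset_card_le _)

theorem IsPathFamily.two_le_length (hr : IsPathFamily (n + 4) r f) {j : ℕ} (hj : j < n + 4) :
    2 ≤ (r j).length := (by omega : 2 ≤ 3).trans (hr.three_le_length hj)

theorem isSegment_newBlocks (hr : IsPathFamily (n + 4) r f)
    (hy : Set.InjOn y (Set.Iio (n + 4))) :
    IsSegment (newBlocks y r f n) (newTriple (y 1) none (some (f 1)))
      (mixedTriple (y 0) (y (n + 3)) (some (f 0))) := by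
  have hyne : ∀ i j, i < n + 4 → j < n + 4 → i ≠ j → y i ≠ y j := fun i j hi hj hij h =>
    hij (hy hi hj h)
  have hn2 := hyne (n + 2) (n + 3) (by omega) (by omega) (by omega)
  have hf : f 1 ≠ f 0 := hr.f_ne (by omega) (by omega) (by omega)
  have hlen := hr.three_le_length (show 0 < n + 4 by omega)
  obtain ⟨t, ht⟩ := hr.start
  have hnodup := hr.nodup 0 (by omega)
  have hlast := hr.last 0 (by omega)
  obtain ⟨c1, d1, hc1, hd1, s1⟩ := isSegment_innerCone (y 1) (hr.nodup 1 (by omega))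
    (hr.two_le_length (by omega)) (hr.head 1 (by omega)) (hr.last 1 (by omega))
  -- The triple `{y 0, f 0, f 2}` is traded away, so this cone starts at `f 2`, the second vertex of
  -- `r 0`.
  obtain ⟨c0, d0, hc0, hd0, s0⟩ := isSegment_innerCone (y 0) (l := (r 0).tail) (a := f 2)
    (b := f 1) hnodup.tail (by simp; omega) (by simp [ht])
    (by rw [ht] at hlast ⊢; simpa using hlast)
  obtain ⟨cn, dn, hcn, hdn, sn⟩ := isSegment_innerCone (y (n + 3)) (hr.nodup (n + 3) (by omega))
    (hr.two_le_length (by omega)) (hr.head (n + 3) (by omega)) (hr.last (n + 3) (by omega))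
  have sm := isSegment_middleCones hr (fun j hj => hr.two_le_length hj) hy (m := n) (by omega)
  have hclosed : f (n + 3 + 1) = f 0 := hr.closed
  rw [hclosed] at sn
  -- The list is built from its end, so the links are proved in reverse order along the cycle.
  refine (s1.append ((s0.append (((sm.append ((sn.concat ?_).cons ?_) ?_).cons ?_).cons ?_ |>.cons ?_)
    ?_).cons ?_) ?_).cons ?_
  · exact linked_of_eq (p := .inl (y (n + 3))) (q := .inr (some (f 0))) (x := .inr (some dn))
      (y := .inl (y 0)) (by unfold newTriple; grind) (by unfold mixedTriple; grind) (by simp)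
      (by simp)
  · exact linked_of_eq (p := .inl (y (n + 3))) (q := .inr (some (f (n + 3)))) (x := .inr none)
      (y := .inr (some cn)) (by unfold newTriple; grind) (by unfold newTriple; grind) (by simp)
      (by simp)
  · exact linked_of_eq (p := .inr none) (q := .inr (some (f (n + 3)))) (x := .inl (y (n + 2)))
      (y := .inl (y (n + 3))) (by unfold newTriple; grind) (by unfold newTriple; grind) (by simp)
      (by simpa using hn2)
  · exact linked_of_eq (p := .inr none) (q := .inr (some (f 2))) (x := .inr (some (f 0)))
      (y := .inl (y 2)) (by grind) (by unfold newTriple; grind) (by simp) (by simp)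
  · exact linked_of_eq (p := .inr none) (q := .inr (some (f 0))) (x := .inl (y 0))
      (y := .inr (some (f 2))) (by unfold newTriple; grind) (by grind) (by simp) (by simp)
  · exact linked_of_eq (p := .inl (y 0)) (q := .inr none) (x := .inr (some (f 1)))
      (y := .inr (some (f 0))) (by unfold newTriple; grind) (by unfold newTriple; grind) (by simp)
      (by simpa using hf)
  · exact linked_of_eq (p := .inl (y 0)) (q := .inr (some (f 1))) (x := .inr (some d0))
      (y := .inr none) (by unfold newTriple; grind) (by unfold newTriple; grind) (by simp)
      (by simp)
  · exact linked_of_eq (p := .inl (y 0)) (q := .inr (some (f 2))) (x := .inl (y 1))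
      (y := .inr (some c0)) (by unfold mixedTriple; grind) (by unfold newTriple; grind) (by simp)
      (by simp)
  · exact linked_of_eq (p := .inl (y 1)) (q := .inr (some (f 2))) (x := .inr (some d1))
      (y := .inl (y 0)) (by unfold newTriple; grind) (by unfold mixedTriple; grind) (by simp)
      (by simp)
  · exact linked_of_eq (p := .inl (y 1)) (q := .inr (some (f 1))) (x := .inr none)
      (y := .inr (some c1)) (by unfold newTriple; grind) (by unfold newTriple; grind) (by simp)
      (by simp)

end Assembly

/-! ### The Pasch trade and the doubled system -/

section Doubling

variable {V Z : Type} [DecidableEq V] [DecidableEq Z] {n : ℕ} {r : ℕ → List Z} {f : ℕ → Z}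
  {y : ℕ → V}

theorem card_mixedTriple {u u' : V} {w : Option Z} (h : u ≠ u') : (mixedTriple u u' w).card = 3 :=
  Finset.card_eq_three.2 ⟨_, _, _, by simpa using h, by simp, by simp, rfl⟩

theorem pairCount_mixedTriple {u u' : V} {w : Option Z} (h : u ≠ u') {x y : V ⊕ Option Z}
    (hxy : x ≠ y) : pairCount x y [mixedTriple u u' w] =
      edgeInd s(x, y) (.inl u) (.inl u') + edgeInd s(x, y) (.inl u) (.inr w) +
        edgeInd s(x, y) (.inl u') (.inr w) :=
  pairCount_triple (by simpa using h) (by simp) (by simp) hxy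

theorem card_of_mem_newBlocks (hr : IsPathFamily (n + 4) r f)
    (hy : Set.InjOn y (Set.Iio (n + 4))) {s : Finset (V ⊕ Option Z)}
    (hs : s ∈ newBlocks y r f n) : s.card = 3 := by
  have hyne : ∀ i j, i < n + 4 → j < n + 4 → i ≠ j → y i ≠ y j := fun i j hi hj hij h =>
    hij (hy hi hj h)
  have hf : f 0 ≠ f 2 := hr.f_ne (by omega) (by omega) (by omega)
  simp only [newBlocks, List.mem_cons, List.mem_append, List.not_mem_nil, or_false] at hs
  rcases hs with rfl | hs | rfl | hs | rfl | rfl | rfl | hs | rfl | hs | rfl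
  · exact card_newTriple (by simp)
  · exact card_of_mem_innerCone (hr.nodup _ (by omega)) hs
  · exact card_mixedTriple (hyne _ _ (by omega) (by omega) (by omega))
  · exact card_of_mem_innerCone (hr.nodup _ (by omega)).tail hs
  · exact card_newTriple (by simp)
  · exact card_newTriple (by simp)
  · exact Finset.card_eq_three.2 ⟨_, _, _, by simp, by simp, by simpa using hf, rfl⟩
  · exact card_of_mem_middleCones hr (by omega) hs
  · exact card_newTriple (by simp)
  · exact card_of_mem_innerCone (hr.nodup _ (by omega)) hs
  · exact card_mixedTriple (hyne _ _ (by omega) (by omega) (by omega))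

/-- The trade: together with the old block `{y 0, y 1, y (n + 3)}`, the blocks taken from the full
cones cover the same pairs as the blocks put in their place. -/
theorem pairCount_newBlocks (hr : IsPathFamily (n + 4) r f)
    (hy : Set.InjOn y (Set.Iio (n + 4))) {p q : V ⊕ Option Z} (hpq : p ≠ q) :
    pairCount p q [mixedTriple (y 1) (y (n + 3)) none] + pairCount p q (newBlocks y r f n) =
      pairCount p q [oldBlock Z {y 0, y 1, y (n + 3)}] + ∑ j ∈ Finset.range (n + 4),
        pairCount p q (fullCone (y j) (r j) (f j) (f (j + 1))) := by
  have hyne : ∀ i j, i < n + 4 → j < n + 4 → i ≠ j → y i ≠ y j := fun i j hi hj hij h =>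
    hij (hy hi hj h)
  have h01 := hyne 0 1 (by omega) (by omega) (by omega)
  have h0n := hyne 0 (n + 3) (by omega) (by omega) (by omega)
  have h1n := hyne 1 (n + 3) (by omega) (by omega) (by omega)
  have hf : f 0 ≠ f 2 := hr.f_ne (by omega) (by omega) (by omega)
  obtain ⟨t, ht⟩ := hr.start
  have hclosed : f (n + 3 + 1) = f 0 := hr.closed
  have h0 : innerCone (y 0) (r 0) =
      newTriple (y 0) (some (f 0)) (some (f 2)) :: innerCone (y 0) (r 0).tail := by
    rw [ht]; rfl
  have hold : oldBlock Z {y 0, y 1, y (n + 3)} = {.inl (y 0), .inl (y 1), .inl (y (n + 3))} := by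
    simp [oldBlock]
  -- Split off the cones `n + 3`, `0` and `1`, which are the ones the trade touches.
  rw [Finset.sum_range_succ, Finset.sum_range_succ', Finset.sum_range_succ', hclosed, hold]
  simp only [zero_add, Nat.reduceAdd, add_assoc, newBlocks, fullCone, h0]
  have hm := pairCount_middleCones p q y r f (n + 1)
  simp only [fullCone] at hm
  rw [← hm]
  simp only [List.cons_append, pairCount_append,
    pairCount_cons p q (newTriple _ _ _) (_ :: _), pairCount_cons p q (newTriple _ _ _) (_ ++ _),
    pairCount_cons p q (mixedTriple _ _ _) (_ ++ _), pairCount_cons p q {_, _, _} (_ ++ _)]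
  -- `tA`–`tD` expand the inserted triples and `tT`, `tX`, `tY`, `tZ` the removed ones; the two sets
  -- of twelve edge indicators agree up to orientation.
  have tA := pairCount_mixedTriple (w := (none : Option Z)) h1n hpq
  have tB := pairCount_mixedTriple (w := some (f 2)) h01 hpq
  have tC := pairCount_mixedTriple (w := some (f 0)) h0n hpq
  have tD := pairCount_triple (a := (.inr none : V ⊕ Option Z)) (b := .inr (some (f 0)))
    (c := .inr (some (f 2))) (by simp) (by simp) (by simpa using hf) hpq
  have tT := pairCount_triple (a := (.inl (y 0) : V ⊕ Option Z)) (b := .inl (y 1))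
    (c := .inl (y (n + 3))) (by simpa using h01) (by simpa using h0n) (by simpa using h1n) hpq
  have tX := pairCount_newTriple (u := y 1) (a := some (f 2)) (b := none) (by simp) hpq
  have tY := pairCount_newTriple (u := y 0) (a := some (f 0)) (b := some (f 2))
    (by simpa using hf) hpq
  have tZ := pairCount_newTriple (u := y (n + 3)) (a := some (f 0)) (b := none) (by simp) hpq
  have e1 := edgeInd_comm s(p, q) (.inr (some (f 0))) (.inr none)
  have e2 := edgeInd_comm s(p, q) (.inr (some (f 2))) (.inr none)
  omega

theorem IsCyclicTTS.double [Fintype V] [Fintype Z] {T : Finset V} {L : List (Finset V)}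
    (h : IsCyclicTTS (n + 4) T L) (hZ : Fintype.card Z = n + 4) (hr : IsPathFamily (n + 4) r f) :
    ∃ (T' : Finset (V ⊕ Option Z)) (L' : List (Finset (V ⊕ Option Z))),
      IsCyclicTTS (2 * (n + 4) + 1) T' L' := by
  obtain ⟨N, P, hL, a, b, c, hab, hac, hbc, hT, haN, hcN, hbP, hcP⟩ := h.exists_triple
  obtain ⟨y, rfl, rfl, rfl, hy⟩ := exists_enumeration h.card_points hab hac hbc
  have hseg := isSegment_newBlocks hr hy.injOn
  have hold : IsSegment (L.map (oldBlock Z)) (oldBlock Z N) (oldBlock Z P) :=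
    ⟨List.isChain_map_of_isChain _ (fun _ _ => Linked.oldBlock) hL.chain, by simp [hL.head],
      by simp [hL.last]⟩
  -- The old path enters at `N`, which contains `y 0` and `y (n + 3)`. It leaves at `P`, which
  -- contains `y 1` and `y (n + 3)` and so links back to the first block.
  have hfull := (hseg.append hold (linked_oldBlock_of_mem hac haN hcN rfl)).cons
    (a := mixedTriple (y 1) (y (n + 3)) none)
    (linked_of_eq (p := .inl (y 1)) (q := .inr none) (x := .inl (y (n + 3)))
      (y := .inr (some (f 1))) (by unfold mixedTriple; grind) rfl (by simp) (by simp))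
  refine ⟨mixedTriple (y 1) (y (n + 3)) none, newBlocks y r f n ++ L.map (oldBlock Z), ?_, ?_, ?_,
    hfull.chain, ?_, ?_⟩
  · simp [h.card_points, hZ]; ring
  · intro s hs
    simp only [List.mem_cons, List.mem_append, List.mem_map] at hs
    rcases hs with rfl | hs | ⟨s, hs, rfl⟩
    · exact card_mixedTriple hbc
    · exact card_of_mem_newBlocks hr hy.injOn hs
    · rw [oldBlock, Finset.card_map]
      exact h.card_block s (by simp [hs])
  · have := h.two_le
    simp; omega
  · intro s hs
    rw [List.getLast?_append, hold.last] at hs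
    simp at hs
    subst hs
    exact (linked_oldBlock_of_mem hbc hbP hcP rfl).symm
  · have key : ∀ p q : V ⊕ Option Z, p ≠ q →
        pairCount p q (mixedTriple (y 1) (y (n + 3)) none ::
          (newBlocks y r f n ++ L.map (oldBlock Z))) =
        pairCount p q ((T :: L).map (oldBlock Z)) + ∑ j ∈ Finset.range (n + 4),
          pairCount p q (fullCone (y j) (r j) (f j) (f (j + 1))) := fun p q hpq => by
      have := pairCount_newBlocks hr hy.injOn hpq
      rw [pairCount_cons, pairCount_append, List.map_cons, pairCount_cons p q (oldBlock Z T), hT]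
      omega
    obtain ⟨h1, h2, h3⟩ := sum_pairCount_fullCone hr hy
    intro p q hpq
    rw [key p q hpq]
    rcases p with p | p <;> rcases q with q | q
    · have hpq' : p ≠ q := by simpa using hpq
      rw [h1 p q hpq', pairCount_inl_inl_old, h.pairCount_eq p q hpq']
    · rw [h2, pairCount_inr_old]
    · rw [pairCount_swap, pairCount_inr_old, zero_add, ← h2 q p]
      exact Finset.sum_congr rfl fun j _ => pairCount_swap _ _ _
    · rw [h3 p q (by simpa using hpq), pairCount_inr_old]

end Doubling

/-! ### Zigzag paths on `ZMod v`, and the odd case -/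

section Zigzag

/-- The offsets `0, 1, -1, 2, -2, …` of a zigzag. -/
def zigOffset (i : ℕ) : ℤ := if i % 2 = 0 then -((i / 2 : ℕ) : ℤ) else ((i + 1) / 2 : ℕ)

/-- The zigzag Hamilton path `u, u + 1, u - 1, u + 2, …` on `ZMod v`. -/
def zigzag (v : ℕ) (u : ZMod v) : List (ZMod v) :=
  (List.range v).map fun i => u + (zigOffset i : ZMod v)

/-- The first `v` offsets are distinct integers that differ pairwise by less than `v`. -/
theorem zigOffset_injOn {v i j : ℕ} (hi : i < v) (hj : j < v)
    (h : (zigOffset i : ZMod v) = zigOffset j) : i = j := by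
  rw [ZMod.intCast_eq_intCast_iff_dvd_sub] at h
  have h0 := Int.eq_zero_of_abs_lt_dvd h (by
    rw [abs_lt]; unfold zigOffset; split_ifs <;> constructor <;> omega)
  unfold zigOffset at h0
  split_ifs at h0 <;> omega

theorem zigOffset_succ_sub (i : ℕ) :
    zigOffset (i + 1) - zigOffset i = i + 1 ∨ zigOffset (i + 1) - zigOffset i = -(i + 1) := by
  unfold zigOffset
  split_ifs <;> omega

theorem zigzag_nodup (v : ℕ) (u : ZMod v) : (zigzag v u).Nodup := by
  refine List.Nodup.map_on (fun i hi j hj h => ?_) List.nodup_range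
  rw [List.mem_range] at hi hj
  exact zigOffset_injOn hi hj (add_left_cancel h)

theorem mem_of_nodup_of_length {Z : Type} [Fintype Z] [DecidableEq Z] {l : List Z} (hl : l.Nodup)
    (hlen : l.length = Fintype.card Z) (w : Z) : w ∈ l := by
  have : l.toFinset = Finset.univ := by
    rw [← Finset.card_eq_iff_eq_univ, List.toFinset_card_of_nodup hl, hlen]
  rw [← List.mem_toFinset, this]
  exact Finset.mem_univ w

theorem length_zigzag (v : ℕ) (u : ZMod v) : (zigzag v u).length = v := by simp [zigzag]

theorem zigzag_head {v : ℕ} (hv : 0 < v) (u : ZMod v) : (zigzag v u).head? = some u := by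
  obtain ⟨n, rfl⟩ := Nat.exists_eq_add_of_lt hv
  simp [zigzag, List.range_succ_eq_map, zigOffset]

theorem zigzag_last (n : ℕ) (u : ZMod (n + 1)) :
    (zigzag (n + 1) u).getLast? = some (u + (zigOffset n : ZMod (n + 1))) := by
  simp [zigzag, List.range_succ]

theorem zigzag_zero_eq (n : ℕ) : ∃ t, zigzag (n + 2) 0 = 0 :: 1 :: t := by
  rw [zigzag, List.range_succ_eq_map, List.range_succ_eq_map]
  exact ⟨_, by simp [zigOffset]; rfl⟩

theorem edgeCount_map_range {Z : Type} [DecidableEq Z] (e : Sym2 Z) (n : ℕ) (g : ℕ → Z) :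
    edgeCount e ((List.range (n + 1)).map g) = ∑ i ∈ Finset.range n, edgeInd e (g i) (g (i + 1)) := by
  induction n generalizing g with
  | zero => rfl
  | succ n ih =>
    have h := ih (g ∘ Nat.succ)
    rw [← List.map_map] at h
    rw [Finset.sum_range_succ', List.range_succ_eq_map, List.map_cons]
    rw [List.range_succ_eq_map, List.map_cons, List.map_cons] at h ⊢
    rw [edgeCount_cons_cons, h, add_comm]
    rfl

theorem sum_comp_of_bijOn {Z : Type} [Fintype Z] {v : ℕ} {f : ℕ → Z}
    (h : Set.BijOn f (Set.Iio v) Set.univ) (g : Z → ℕ) :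
    ∑ j ∈ Finset.range v, g (f j) = ∑ w, g w := by
  refine Finset.sum_nbij f (by simp) ?_ ?_ (fun _ _ => rfl)
  · simpa using h.injOn
  · simpa using h.surjOn

theorem natCast_bijOn (v : ℕ) [NeZero v] :
    Set.BijOn (fun j : ℕ => (j : ZMod v)) (Set.Iio v) Set.univ := by
  refine ⟨fun _ _ => Set.mem_univ _, fun i hi j hj h => ?_, fun w _ =>
    ⟨w.val, w.val_lt, by simp⟩⟩
  have := congrArg ZMod.val h
  simpa [ZMod.val_natCast_of_lt hi, ZMod.val_natCast_of_lt hj] using this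

/-- Step `i` of the zigzag has difference `±(i + 1)`. Hence exactly one translate places a given
pair at that step for each of `b - a`, `a - b` that equals `i + 1`. As `i + 1` runs once through the
nonzero residues, each of the two differences contributes one. -/
theorem sum_edgeCount_zigzag_succ (n : ℕ) {a b : ZMod (n + 1)} (hab : a ≠ b) :
    ∑ u, edgeCount s(a, b) (zigzag (n + 1) u) = 2 := by
  have hone : ∀ c : ZMod (n + 1), c ≠ 0 →
      ∑ i ∈ Finset.range n, (if ((i : ZMod (n + 1)) + 1) = c then 1 else 0) = 1 := fun c hc => by
    have := sum_indicator_of_bijOn (natCast_bijOn (n + 1)) c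
    rw [Finset.sum_range_succ'] at this
    simpa [hc.symm] using this
  have hpair : ∀ i, ∑ u : ZMod (n + 1),
      edgeInd s(a, b) (u + (zigOffset i : ZMod (n + 1))) (u + (zigOffset (i + 1) : ZMod (n + 1))) =
      (if ((i : ZMod (n + 1)) + 1) = b - a then 1 else 0) +
        (if ((i : ZMod (n + 1)) + 1) = a - b then 1 else 0) := fun i => by
    have hsplit : ∀ p q : ZMod (n + 1), ∀ u, edgeInd s(a, b) (u + p) (u + q) =
        (if u = a - p then (if q - p = b - a then 1 else 0) else 0) +
        (if u = b - p then (if q - p = a - b then 1 else 0) else 0) := fun p q u => by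
      have e1 : (u = a - p ∧ q - p = b - a) ↔ (a = u + p ∧ b = u + q) := by
        constructor
        · rintro ⟨rfl, h⟩
          exact ⟨by ring, by linear_combination -h⟩
        · rintro ⟨rfl, rfl⟩
          exact ⟨by ring, by ring⟩
      have e2 : (u = b - p ∧ q - p = a - b) ↔ (a = u + q ∧ b = u + p) := by
        constructor
        · rintro ⟨rfl, h⟩
          exact ⟨by linear_combination -h, by ring⟩
        · rintro ⟨rfl, rfl⟩
          exact ⟨by ring, by ring⟩
      simp only [← ite_and, edgeInd, Sym2.eq_iff, e1, e2]
      by_cases h1 : a = u + p ∧ b = u + q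
      · have h2 : ¬ (a = u + q ∧ b = u + p) := fun h2 => hab (h1.1.trans h2.2.symm)
        rw [if_pos h1, if_neg h2, if_pos (Or.inl h1)]
      · rw [if_neg h1, zero_add]
        simp [h1]
    simp only [hsplit, Finset.sum_add_distrib, Finset.sum_ite_eq', Finset.mem_univ, if_true]
    have hneg : ∀ x : ZMod (n + 1), (-x = b - a ↔ x = a - b) ∧ (-x = a - b ↔ x = b - a) :=
      fun x => ⟨by rw [neg_eq_iff_eq_neg, neg_sub], by rw [neg_eq_iff_eq_neg, neg_sub]⟩
    rcases zigOffset_succ_sub i with h | h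
    · have h' := congrArg (Int.cast : ℤ → ZMod (n + 1)) h
      push_cast at h'
      rw [h']
    · have h' := congrArg (Int.cast : ℤ → ZMod (n + 1)) h
      push_cast at h'
      rw [h']
      simp only [(hneg _).1, (hneg _).2]
      rw [add_comm]
  simp only [zigzag, edgeCount_map_range]
  rw [Finset.sum_comm]
  simp only [hpair, Finset.sum_add_distrib]
  rw [hone _ (sub_ne_zero.2 hab.symm), hone _ (sub_ne_zero.2 hab)]

/-- Over all translates, the zigzag joins each pair of points exactly twice. -/
theorem sum_edgeCount_zigzag {v : ℕ} [NeZero v] {a b : ZMod v} (hab : a ≠ b) :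
    ∑ u, edgeCount s(a, b) (zigzag v u) = 2 := by
  obtain ⟨n, rfl⟩ : ∃ n, v = n + 1 := Nat.exists_eq_succ_of_ne_zero (NeZero.ne v)
  exact sum_edgeCount_zigzag_succ n hab

/-- The zigzag from `u` ends at `u - m`, so the starting points must be the multiples of `-m`. This
is the inverse of `2`, so they exhaust `ZMod (2 * m + 1)`, and `f 2 = 1` is the second vertex of the
zigzag from `0`. -/
theorem exists_isPathFamily_odd (m : ℕ) (hm : 1 ≤ m) :
    ∃ r f, IsPathFamily (Z := ZMod (2 * m + 1)) (2 * m + 1) r f := by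
  have hv : ((2 * m + 1 : ℕ) : ZMod (2 * m + 1)) = 0 := ZMod.natCast_self _
  have h2m : (2 : ZMod (2 * m + 1)) * (-m) = 1 := by
    push_cast at hv
    linear_combination -hv
  let f : ℕ → ZMod (2 * m + 1) := fun j => (-m) * j
  have hbij : Set.BijOn f (Set.Iio (2 * m + 1)) Set.univ := by
    refine ⟨fun _ _ => Set.mem_univ _, fun i hi j hj h => ?_, fun w _ => ?_⟩
    · refine (natCast_bijOn (2 * m + 1)).injOn hi hj ?_
      simp only [f] at h
      linear_combination 2 * h - (i - j : ZMod (2 * m + 1)) * h2m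
    · refine ⟨(2 * w).val, (2 * w).val_lt, ?_⟩
      simp only [f, ZMod.natCast_val, ZMod.cast_id', id]
      linear_combination w * h2m
  refine ⟨fun j => zigzag _ (f j), f, fun j _ => zigzag_nodup _ _,
    fun j _ => mem_of_nodup_of_length (zigzag_nodup _ _) (by rw [length_zigzag, ZMod.card]),
    fun j _ => zigzag_head (by omega) _, fun j _ => ?_, ?_, ?_, hbij, fun a b hab => ?_⟩
  · rw [zigzag_last]
    have : zigOffset (2 * m) = -m := by unfold zigOffset; split_ifs <;> omega
    rw [this]
    simp only [f]; push_cast; congr 1; ring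
  · simp only [f, hv]; simp
  · obtain ⟨k, rfl⟩ : ∃ k, m = k + 1 := ⟨m - 1, by omega⟩
    obtain ⟨t, ht⟩ := zigzag_zero_eq (2 * k + 1)
    refine ⟨t, ?_⟩
    have h0 : f 0 = 0 := by simp [f]
    have h2 : f 2 = 1 := by
      rw [← h2m]; simp only [f]; push_cast; ring
    rw [h0, h2]
    exact ht
  · rw [sum_comp_of_bijOn hbij fun u => edgeCount s(a, b) (zigzag (2 * m + 1) u)]
    exact sum_edgeCount_zigzag hab

end Zigzag

/-! ### The even case -/

section Even

/-- The cyclic shift of `0, …, h - 1`, fixing all other natural numbers. -/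
def lowShift (h k : ℕ) : ℕ := if k + 1 < h then k + 1 else if k + 1 = h then 0 else k

theorem lowShift_lt {h k : ℕ} (hk : k < 2 * h) : lowShift h k < 2 * h := by
  unfold lowShift; split_ifs <;> omega

theorem lowShift_inj {h k l : ℕ} (e : lowShift h k = lowShift h l) : k = l := by
  unfold lowShift at e; split_ifs at e <;> omega

/-- The cyclic shift of the lower half of `ZMod (2 * h)`. -/
def halfShift (h : ℕ) (x : ZMod (2 * h)) : ZMod (2 * h) := (lowShift h x.val : ZMod (2 * h))

theorem halfShift_natCast {h k : ℕ} (hk : k < 2 * h) :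
    halfShift h (k : ZMod (2 * h)) = (lowShift h k : ZMod (2 * h)) := by
  rw [halfShift, ZMod.val_natCast_of_lt hk]

theorem halfShift_injective {h : ℕ} (hh : 0 < h) : Function.Injective (halfShift h) := by
  have : NeZero (2 * h) := ⟨by omega⟩
  intro x y hxy
  have h1 := (natCast_bijOn (2 * h)).injOn (lowShift_lt x.val_lt) (lowShift_lt y.val_lt) hxy
  exact ZMod.val_injective _ (lowShift_inj h1)

theorem sum_range_two_mul (F : ℕ → ℕ) (h : ℕ) :
    ∑ j ∈ Finset.range (2 * h), F j = ∑ u ∈ Finset.range h, (F (2 * u) + F (2 * u + 1)) := by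
  induction h with
  | zero => rfl
  | succ h ih =>
    rw [show 2 * (h + 1) = 2 * h + 1 + 1 by ring, Finset.sum_range_succ, Finset.sum_range_succ, ih,
      Finset.sum_range_succ]
    ring

/-- On an even number of points, the opposite zigzag is the reversed one. -/
theorem edgeCount_zigzag_add_half {h : ℕ} (hh : 0 < h) (e : Sym2 (ZMod (2 * h)))
    (u : ZMod (2 * h)) :
    edgeCount e (zigzag (2 * h) (u + h)) = edgeCount e (zigzag (2 * h) u) := by
  obtain ⟨n, hn⟩ : ∃ n, 2 * h = n + 1 := ⟨2 * h - 1, by omega⟩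
  have hz : ((2 * h : ℕ) : ZMod (2 * h)) = 0 := ZMod.natCast_self _
  push_cast at hz
  have hoff : ∀ i ≤ n, u + h + (zigOffset i : ZMod (2 * h)) =
      u + (zigOffset (n - i) : ZMod (2 * h)) := fun i hi => by
    -- Reversing the index shifts the offset by `h` modulo `2 * h`.
    have : zigOffset (n - i) = zigOffset i + h ∨ zigOffset (n - i) = zigOffset i + h - 2 * h := by
      unfold zigOffset; split_ifs <;> omega
    rcases this with e | e
    · rw [e]; push_cast; ring
    · rw [e]; push_cast; linear_combination hz
  have hrange : ∀ w : ZMod (2 * h), zigzag (2 * h) w =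
      (List.range (n + 1)).map fun i => w + (zigOffset i : ZMod (2 * h)) := fun w => by
    rw [zigzag, ← hn]
  rw [hrange, hrange, edgeCount_map_range, edgeCount_map_range, ← Finset.sum_range_reflect]
  refine Finset.sum_congr rfl fun i hi => ?_
  rw [Finset.mem_range] at hi
  rw [hoff _ (by omega), hoff _ (by omega), edgeInd_comm]
  congr 3
  · congr 2; omega
  · congr 2; omega

/-- The zigzag from `u` ends at `u + h`, and the one from `u + h` runs straight back, so unmodified
translates cannot be chained into one cycle. The zigzags from `0, …, h - 1` alone join each pair
once. Applying `halfShift` to the other `h` zigzags keeps this property and makes them run from `u +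
h` to `u + 1`, so the ends go `0, h, 1, h + 1, 2, …`. -/
theorem exists_isPathFamily_even (h : ℕ) (hh : 2 ≤ h) :
    ∃ r f, IsPathFamily (Z := ZMod (2 * h)) (2 * h) r f := by
  have hh0 : 0 < h := by omega
  have : NeZero (2 * h) := ⟨by omega⟩
  obtain ⟨n, hn⟩ : ∃ n, 2 * h = n + 2 := ⟨2 * h - 2, by omega⟩
  have hz : ((2 * h : ℕ) : ZMod (2 * h)) = 0 := ZMod.natCast_self _
  push_cast at hz
  -- The reduction modulo `h` matters only at `j = 2 * h`, where it gives `f (2 * h) = f 0`.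
  let k : ℕ → ℕ := fun j => if j % 2 = 0 then j / 2 % h else j / 2 + h
  let f : ℕ → ZMod (2 * h) := fun j => (k j : ZMod (2 * h))
  let r : ℕ → List (ZMod (2 * h)) := fun j =>
    if j % 2 = 0 then zigzag (2 * h) (f j) else (zigzag (2 * h) (f j)).map (halfShift h)
  have hk : ∀ u < h, k (2 * u) = u ∧ k (2 * u + 1) = u + h := fun u hu => by
    constructor
    · simp only [k]
      rw [if_pos (by omega), show 2 * u / 2 = u by omega, Nat.mod_eq_of_lt hu]
    · simp only [k]
      rw [if_neg (by omega), show (2 * u + 1) / 2 = u by omega]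
  have hcases : ∀ j < 2 * h, ∃ u < h, j = 2 * u ∨ j = 2 * u + 1 := fun j hj =>
    ⟨j / 2, by omega, by omega⟩
  have hr0 : ∀ u, r (2 * u) = zigzag (2 * h) (f (2 * u)) := fun u => if_pos (by omega)
  have hr1 : ∀ u, r (2 * u + 1) = (zigzag (2 * h) (f (2 * u + 1))).map (halfShift h) :=
    fun u => if_neg (by omega)
  have hf0 : ∀ u < h, f (2 * u) = u := fun u hu => by simp only [f, (hk u hu).1]
  have hf1 : ∀ u < h, f (2 * u + 1) = u + h := fun u hu => by
    simp only [f, (hk u hu).2]; push_cast; rfl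
  have hbij : Set.BijOn f (Set.Iio (2 * h)) Set.univ := by
    refine ⟨fun _ _ => Set.mem_univ _, fun i hi j hj e => ?_, fun w _ => ?_⟩
    · obtain ⟨u, hu, hu'⟩ := hcases i hi
      obtain ⟨u', hu2, hu2'⟩ := hcases j hj
      have h1 := hk u hu
      have h2 := hk u' hu2
      have : k i = k j := (natCast_bijOn (2 * h)).injOn
        (by simp only [Set.mem_Iio]; rcases hu' with rfl | rfl <;> omega)
        (by simp only [Set.mem_Iio]; rcases hu2' with rfl | rfl <;> omega) e
      rcases hu' with rfl | rfl <;> rcases hu2' with rfl | rfl <;> omega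
    · have hw := w.val_lt
      by_cases hlow : w.val < h
      · exact ⟨2 * w.val, by simp; omega, by rw [hf0 _ hlow]; simp⟩
      · refine ⟨2 * (w.val - h) + 1, by simp only [Set.mem_Iio]; omega, ?_⟩
        rw [hf1 _ (by omega), Nat.cast_sub (by omega)]; simp
  have hnodup : ∀ j, (r j).Nodup := fun j => by
    simp only [r]
    split_ifs
    · exact zigzag_nodup _ _
    · exact (zigzag_nodup _ _).map (halfShift_injective hh0)
  have hlast : ∀ u, (zigzag (2 * h) u).getLast? = some (u + h) := fun u => by
    have : zigOffset (2 * h - 1) = h := by unfold zigOffset; split_ifs <;> omega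
    have h1 : 2 * h = 2 * h - 1 + 1 := by omega
    rw [zigzag, show List.range (2 * h) = List.range (2 * h - 1 + 1) by rw [← h1],
      List.range_succ]
    simp [this]
  refine ⟨r, f, fun j _ => hnodup j, fun j _ => mem_of_nodup_of_length (hnodup j) ?_,
    fun j hj => ?_, fun j hj => ?_, ?_, ?_, hbij, fun a b hab => ?_⟩
  · rw [ZMod.card]
    simp only [r]
    split_ifs <;> simp [length_zigzag]
  · obtain ⟨u, hu, rfl | rfl⟩ := hcases j hj
    · rw [hr0, zigzag_head (by omega)]
    · rw [hr1, List.head?_map, zigzag_head (by omega)]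
      simp only [f, Option.map_some, (hk u hu).2]
      rw [halfShift_natCast (by omega), lowShift, if_neg (by omega), if_neg (by omega)]
  · obtain ⟨u, hu, rfl | rfl⟩ := hcases j hj
    · rw [hr0, hlast, hf0 u hu, hf1 u hu]
    · rw [hr1, List.getLast?_map, hlast, hf1 u hu, Option.map_some]
      have h1 : (u : ZMod (2 * h)) + h + h = u := by linear_combination hz
      rw [h1, halfShift_natCast (by omega)]
      congr 2
      simp only [k]
      rw [if_pos (by omega), show (2 * u + 1 + 1) / 2 = u + 1 by omega, lowShift]
      split_ifs with h2 h3
      · rw [Nat.mod_eq_of_lt h2]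
      · rw [h3, Nat.mod_self]
      · omega
  · simp [f, k]
  · obtain ⟨t, ht⟩ := zigzag_zero_eq n
    have h0 : f 0 = 0 := by simpa using hf0 0 hh0
    have h2 : f 2 = 1 := by simpa using hf0 1 (by omega)
    rw [h0, h2]
    have : r 0 = zigzag (2 * h) 0 := by rw [← h0]; exact hr0 0
    rw [this, hn]
    exact ⟨t, ht⟩
  -- All translates join each pair twice, and opposite translates have the same edges, so half of
  -- them join it once.
  · have hE : ∀ a b : ZMod (2 * h), a ≠ b →
        ∑ u ∈ Finset.range h, edgeCount s(a, b) (zigzag (2 * h) (u : ZMod (2 * h))) = 1 := by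
      intro a b hab
      have h1 := sum_edgeCount_zigzag hab
      rw [← sum_comp_of_bijOn hbij fun u => edgeCount s(a, b) (zigzag (2 * h) u),
        sum_range_two_mul] at h1
      have h2 : ∀ u ∈ Finset.range h, edgeCount s(a, b) (zigzag (2 * h) (f (2 * u))) +
          edgeCount s(a, b) (zigzag (2 * h) (f (2 * u + 1))) =
          2 * edgeCount s(a, b) (zigzag (2 * h) (u : ZMod (2 * h))) := fun u hu => by
        rw [Finset.mem_range] at hu
        rw [hf0 u hu, hf1 u hu, edgeCount_zigzag_add_half hh0]
        ring
      rw [Finset.sum_congr rfl h2, ← Finset.mul_sum] at h1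
      omega
    -- Pulling the pair back along the bijection `halfShift` reduces the shifted paths to the plain
    -- zigzags.
    obtain ⟨a', rfl⟩ := Finite.surjective_of_injective (halfShift_injective hh0) a
    obtain ⟨b', rfl⟩ := Finite.surjective_of_injective (halfShift_injective hh0) b
    have hab' : a' ≠ b' := fun e => hab (by rw [e])
    rw [sum_range_two_mul, Finset.sum_add_distrib]
    have s0 : ∑ u ∈ Finset.range h, edgeCount s(halfShift h a', halfShift h b') (r (2 * u)) = 1 := by
      refine (Finset.sum_congr rfl fun u hu => ?_).trans (hE _ _ hab)
      rw [hr0, hf0 u (by simpa using hu)]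
    have s1 : ∑ u ∈ Finset.range h,
        edgeCount s(halfShift h a', halfShift h b') (r (2 * u + 1)) = 1 := by
      refine (Finset.sum_congr rfl fun u hu => ?_).trans (hE _ _ hab')
      rw [hr1, hf1 u (by simpa using hu), ← Sym2.map_mk, edgeCount_map (halfShift_injective hh0),
        edgeCount_zigzag_add_half hh0]
    rw [s0, s1]

end Even

theorem theorem3p1 (v : ℕ) (hodd : Odd v → 7 ≤ v) (heven : Even v → 4 ≤ v)
    (h : ExistsTTSWithHamiltonianTwoBIG v) :
    ExistsTTSWithHamiltonianTwoBIG (2 * v + 1) := by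
  have hv : 4 ≤ v := by
    rcases Nat.even_or_odd v with hv | hv
    · exact heven hv
    · have := hodd hv; omega
  obtain ⟨V, _, _, T, L, hL⟩ := exists_isCyclicTTS (by omega) h
  have hfam : ∃ r f, IsPathFamily (Z := ZMod v) v r f := by
    rcases Nat.even_or_odd' v with ⟨m, rfl | rfl⟩
    · exact exists_isPathFamily_even m (by omega)
    · exact exists_isPathFamily_odd m (by omega)
  obtain ⟨r, f, hr⟩ := hfam
  obtain ⟨n, rfl⟩ : ∃ n, v = n + 4 := ⟨v - 4, by omega⟩
  obtain ⟨T', L', h'⟩ := hL.double (ZMod.card _) hr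
  exact h'.existsTTS
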